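/- Let $0\le k\le n$ be integers, $[n]=\{1,\dots,n\}$, and let $\mathrm{Gr}(k,n)$ be the real Grassmannian of $k$-dimensional linear subspaces of $\mathbb{R}^n$. For $X\in \mathrm{Gr}(k,n)$, the Plücker coordinates $\Delta_I(X)$, $I\in\binom{[n]}{k}$, are the maximal minors (with columns in increasing order) of a $k\times n$ matrix whose row space is $X$; they are defined up to a common non-zero scalar. Call $X$ totally nonnegative if they can be chosen so that $\Delta_I(X)\ge 0$ for all $I$. The matroid of $X$ is the matroid $\mathcal{M}_X$ on $[n]$ whose collection of bases is $\{I\in\binom{[n]}{k} : \Delta_I(X)\neq 0\}$. A positroid is a matroid of the form $\mathcal{M}_X$ with $X$ totally nonnegative. For $I,J\in\binom{[n]}{k}$, let $a_1\le b_1\le a_2\le b_2\le\cdots\le a_k\le b_k$ be the sorted list of the elements of the multiset union of $I$ and $J$ (elements of $I\cap J$ are listed twice), and put $\mathrm{sort}_1(I,J)=\{a_1,\dots,a_k\}$ and $\mathrm{sort}_2(I,J)=\{b_1,\dots,b_k\}$. Then every positroid $\mathcal{M}$ is sort-closed: if $I$ and $J$ are bases of $\mathcal{M}$, then $\mathrm{sort}_1(I,J)$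 and $\mathrm{sort}_2(I,J)$ are also bases of $\mathcal{M}$. -/

import Mathlib

/-- The real Grassmannian of `k`-dimensional linear subspaces of `ℝⁿ`. -/
abbrev RealGr (k n : ℕ) : Type :=
  {X : Submodule ℝ (Fin n → ℝ) // Module.finrank ℝ X = k}

/-- The maximal minor of a `k × n` matrix with columns `I`, taken in increasing order. -/
noncomputable def maximalMinor {k n : ℕ} (A : Matrix (Fin k) (Fin n) ℝ)
    (I : Set.powersetCard (Fin n) k) : ℝ :=
  (A.submatrix id ((I : Finset (Fin n)).orderEmbOfFin I.2)).det

namespace RealGr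

variable {k n : ℕ}

/-- `A` represents `X` if `X` is the row space of `A`.  As `A` has `k = dim X` rows, its rows are
then a basis of `X`, and its maximal minors are the Plücker coordinates of `X`, which are defined
up to a single common non-zero scalar. -/
def IsRepresentedBy (X : RealGr k n) (A : Matrix (Fin k) (Fin n) ℝ) : Prop :=
  Submodule.span ℝ (Set.range A.row) = X.1

/-- `X` is totally nonnegative if it has a representative with nonnegative Plücker coordinates. -/
def IsTotallyNonneg (X : RealGr k n) : Prop :=
  ∃ A : Matrix (Fin k) (Fin n) ℝ, X.IsRepresentedBy A ∧ ∀ I, 0 ≤ maximalMinor A I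

/-- The collection of `k`-element subsets labelling non-vanishing Plücker coordinates of `X`.
By `mem_nonvanishing_iff`, it does not matter which representative is taken. -/
def nonvanishing (X : RealGr k n) : Set (Set.powersetCard (Fin n) k) :=
  {I | ∃ A : Matrix (Fin k) (Fin n) ℝ, X.IsRepresentedBy A ∧ maximalMinor A I ≠ 0}

theorem exists_isRepresentedBy (X : RealGr k n) : ∃ A, X.IsRepresentedBy A := by
  let b := Module.finBasisOfFinrankEq ℝ X.1 X.2
  refine ⟨Matrix.of fun i => (b i : Fin n → ℝ), ?_⟩
  have h : Set.range (Matrix.of fun i => (b i : Fin n → ℝ)).row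
      = X.1.subtype '' Set.range b := by
    rw [← Set.range_comp]; rfl
  rw [IsRepresentedBy, h, Submodule.span_image, b.span_eq, Submodule.map_subtype_top]

theorem mem_nonvanishing_iff {X : RealGr k n} {A : Matrix (Fin k) (Fin n) ℝ}
    (hA : X.IsRepresentedBy A) (I : Set.powersetCard (Fin n) k) :
    I ∈ X.nonvanishing ↔ maximalMinor A I ≠ 0 := by
  refine ⟨?_, fun h => ⟨A, hA, h⟩⟩
  rintro ⟨B, hB, h⟩
  have hg : ∀ i, ∃ c : Fin k → ℝ, ∑ j, c j • A.row j = B.row i := fun i => by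
    rw [← Submodule.mem_span_range_iff_exists_fun, hA, ← hB]
    exact Submodule.subset_span ⟨i, rfl⟩
  choose g hg using hg
  have hdet : maximalMinor B I = (Matrix.of g).det * maximalMinor A I := by
    rw [maximalMinor, maximalMinor, ← Matrix.det_mul]
    congr 1
    ext i j
    have := congrFun (hg i) ((I : Finset (Fin n)).orderEmbOfFin I.2 j)
    simpa [Matrix.mul_apply, Matrix.row] using this.symm
  exact right_ne_zero_of_mul (hdet ▸ h)

theorem mem_nonvanishing_iff_linearIndepOn {X : RealGr k n} {A : Matrix (Fin k) (Fin n) ℝ}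
    (hA : X.IsRepresentedBy A) (I : Set.powersetCard (Fin n) k) :
    I ∈ X.nonvanishing ↔ LinearIndepOn ℝ A.col ((I : Finset (Fin n)) : Set (Fin n)) := by
  rw [mem_nonvanishing_iff hA, maximalMinor, ← isUnit_iff_ne_zero, ← Matrix.isUnit_iff_isUnit_det,
    ← Matrix.linearIndependent_cols_iff_isUnit]
  exact linearIndependent_equiv' (((I : Finset (Fin n)).orderIsoOfFin I.2).toEquiv) rfl

/-- `B` is, as a set, an element of the collection `X.nonvanishing`. -/
def IsBase (X : RealGr k n) (B : Set (Fin n)) : Prop :=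
  ∃ I ∈ X.nonvanishing, ((I : Finset (Fin n)) : Set (Fin n)) = B

theorem isBase_iff {X : RealGr k n} {A : Matrix (Fin k) (Fin n) ℝ}
    (hA : X.IsRepresentedBy A) (B : Set (Fin n)) :
    X.IsBase B ↔ B.ncard = k ∧ LinearIndepOn ℝ A.col B := by
  constructor
  · rintro ⟨I, hI, rfl⟩
    exact ⟨by rw [Set.ncard_coe_finset]; exact I.2,
      (mem_nonvanishing_iff_linearIndepOn hA I).1 hI⟩
  · rintro ⟨hB, h⟩
    classical
    refine ⟨⟨B.toFinset, ?_⟩, (mem_nonvanishing_iff_linearIndepOn hA _).2 ?_, ?_⟩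
    · simpa [Set.powersetCard, Set.ncard_eq_toFinset_card'] using hB
    · simpa using h
    · simp

theorem exists_isBase (X : RealGr k n) : ∃ B, X.IsBase B := by
  obtain ⟨A, hA⟩ := X.exists_isRepresentedBy
  obtain ⟨κ, a, ha, hspan, hli⟩ := exists_linearIndependent' ℝ A.col
  refine ⟨Set.range a, (isBase_iff hA _).2 ⟨?_, (linearIndepOn_range_iff ha _).2 hli⟩⟩
  have hfin : Finite κ := Finite.of_injective a ha
  have := Fintype.ofFinite κ
  have h1 : A.rank = k := by
    rw [Matrix.rank_eq_finrank_span_row, hA, X.2]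
  rw [Matrix.rank_eq_finrank_span_cols, ← hspan, finrank_span_eq_card hli] at h1
  rw [← Set.image_univ, Set.ncard_image_of_injective _ ha, Set.ncard_univ,
    Nat.card_eq_fintype_card, h1]

theorem isBase_exchange (X : RealGr k n) : Matroid.ExchangeProperty X.IsBase := by
  obtain ⟨A, hA⟩ := X.exists_isRepresentedBy
  intro B C hB hC a ha
  rw [isBase_iff hA] at hB hC
  have hBa : LinearIndepOn ℝ A.col (B \ {a}) := hB.2.mono Set.sdiff_subset
  obtain ⟨b, hbC, hb⟩ : ∃ b ∈ C, A.col b ∉ Submodule.span ℝ (A.col '' (B \ {a})) := by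
    by_contra! hcon
    have hle : Submodule.span ℝ (A.col '' C) ≤ Submodule.span ℝ (A.col '' (B \ {a})) := by
      rw [Submodule.span_le]
      rintro _ ⟨c, hc, rfl⟩
      exact hcon c hc
    have hfr : ∀ S : Set (Fin n), LinearIndepOn ℝ A.col S →
        Module.finrank ℝ (Submodule.span ℝ (A.col '' S)) = S.ncard := fun S hS => by
      classical
      rw [Set.image_eq_range, finrank_span_eq_card hS, ← Nat.card_eq_fintype_card,
        Nat.card_coe_set_eq]
    have h := Submodule.finrank_mono hle
    rw [hfr _ hC.2, hfr _ hBa, hC.1, ← hB.1] at h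
    exact absurd (Set.ncard_sdiff_singleton_lt_of_mem ha.1) (not_lt.2 h)
  have hbB : b ∉ B \ {a} := fun h => hb (Submodule.subset_span ⟨b, h, rfl⟩)
  refine ⟨b, ⟨hbC, fun h => hbB ⟨h, ?_⟩⟩, (isBase_iff hA _).2 ⟨?_, hBa.insert hb⟩⟩
  · rintro rfl
    exact ha.2 hbC
  · rw [Set.ncard_insert_of_notMem hbB, Set.ncard_sdiff_singleton_add_one ha.1, hB.1]

/-- The matroid of `X`: its bases are the `k`-element subsets labelling non-vanishing Plücker
coordinates of `X`. -/
def matroid (X : RealGr k n) : Matroid (Fin n) :=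
  Matroid.ofIsBaseOfFinite (E := Set.univ) Set.finite_univ X.IsBase X.exists_isBase
    X.isBase_exchange fun _ _ => Set.subset_univ _

end RealGr

/-- A positroid of rank `k` on the ground set `Fin n`. -/
def IsPositroid (k : ℕ) {n : ℕ} (M : Matroid (Fin n)) : Prop :=
  ∃ X : RealGr k n, X.IsTotallyNonneg ∧ M = X.matroid

section Sorting

variable {k n : ℕ}

/-- The multiset union of `I` and `J`, with multiplicities added, as a weakly increasing list
`a₁ ≤ b₁ ≤ a₂ ≤ b₂ ≤ ⋯ ≤ aₖ ≤ bₖ`. -/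
def sortedUnion (I J : Set.powersetCard (Fin n) k) : List (Fin n) :=
  ((I : Finset (Fin n)).val + (J : Finset (Fin n)).val).sort (· ≤ ·)

theorem length_sortedUnion (I J : Set.powersetCard (Fin n) k) :
    (sortedUnion I J).length = 2 * k := by
  have hI : (I : Finset (Fin n)).card = k := I.2
  have hJ : (J : Finset (Fin n)).card = k := J.2
  simp [sortedUnion, hI, hJ, two_mul]

/-- The set `{a₁, …, aₖ}` of entries in odd position (counted from `1`) of the sorted union. -/
def sort₁ (I J : Set.powersetCard (Fin n) k) : Finset (Fin n) :=
  Finset.univ.image fun i : Fin k =>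
    (sortedUnion I J)[2 * (i : ℕ)]'(by rw [length_sortedUnion]; omega)

/-- The set `{b₁, …, bₖ}` of entries in even position (counted from `1`) of the sorted union. -/
def sort₂ (I J : Set.powersetCard (Fin n) k) : Finset (Fin n) :=
  Finset.univ.image fun i : Fin k =>
    (sortedUnion I J)[2 * (i : ℕ) + 1]'(by rw [length_sortedUnion]; omega)

end Sorting

/-- A matroid on `Fin n` is sort-closed if with any two bases `I`, `J` (which have the same size
`k`), also `sort₁ I J` and `sort₂ I J` are bases. -/
def IsSortClosed {n : ℕ} (M : Matroid (Fin n)) : Prop :=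
  ∀ (k : ℕ) (I J : Set.powersetCard (Fin n) k),
    M.IsBase (I : Finset (Fin n)) → M.IsBase (J : Finset (Fin n)) →
      M.IsBase (sort₁ I J) ∧ M.IsBase (sort₂ I J)

/-- The positions `i` at which membership in `S` changes between `i` and `i + 1`. -/
def memberChanges {n : ℕ} (S : Finset (Fin n)) : Finset (Fin n) :=
  Finset.univ.filter fun i => ∃ h : (i : ℕ) + 1 < n, ¬ (i ∈ S ↔ (⟨i + 1, h⟩ : Fin n) ∈ S)

theorem memberChanges_compl {n : ℕ} (S : Finset (Fin n)) :
    memberChanges Sᶜ = memberChanges S := by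
  ext i
  simp only [memberChanges, Finset.mem_filter, Finset.mem_univ, true_and, Finset.mem_compl,
    not_iff_not]

theorem exists_mem_memberChanges {n : ℕ} {S : Finset (Fin n)} {x y : Fin n} (hxy : x < y)
    (h : ¬ (x ∈ S ↔ y ∈ S)) : ∃ i ∈ memberChanges S, x ≤ i ∧ i < y := by
  by_contra! hcon
  have key : ∀ j : ℕ, ∀ hj : j < n, (x : ℕ) ≤ j → j ≤ y → (x ∈ S ↔ (⟨j, hj⟩ : Fin n) ∈ S) := by
    intro j hj hx
    induction j, hx using Nat.le_induction with
    | base => intro _; rfl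
    | succ j hx ih =>
      intro hy
      rw [ih (by omega) (by omega)]
      by_contra hne
      have := hcon ⟨j, by omega⟩ (by simpa [memberChanges] using ⟨hj, hne⟩)
        (Fin.le_def.2 hx)
      rw [Fin.le_def] at this
      simp only at this
      omega
  exact h (key y y.2 hxy.le le_rfl)

/-- Cutting `S` along two points outside of it, with elements of `S` on both sides, lowers the
number of membership changes of both parts. -/
theorem card_memberChanges_inter_lt {n : ℕ} {S : Finset (Fin n)} {b d a c : Fin n}
    (hb : b ∉ S) (hd : d ∉ S) (ha : a ∈ S) (hab : b < a) (had : a < d) (hc : c ∈ S)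
    (hcbd : c < b ∨ d < c) :
    (memberChanges (S ∩ Finset.Ioo b d)).card < (memberChanges S).card ∧
      (memberChanges (S \ Finset.Ioo b d)).card < (memberChanges S).card := by
  have hbd : b < d := hab.trans had
  have h1 : ∀ i ∈ memberChanges (S ∩ Finset.Ioo b d), i ∈ memberChanges S ∧ b ≤ i ∧ i < d := by
    intro i hi
    simp only [memberChanges, Finset.mem_filter, Finset.mem_univ, true_and, Finset.mem_inter,
      Finset.mem_Ioo] at hi ⊢
    obtain ⟨h, hi⟩ := hi
    have e1 : i = b → i ∉ S := fun h => h ▸ hb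
    have e2 : i = d → i ∉ S := fun h => h ▸ hd
    have e3 : (⟨i + 1, h⟩ : Fin n) = b → (⟨i + 1, h⟩ : Fin n) ∉ S := fun h => h ▸ hb
    have e4 : (⟨i + 1, h⟩ : Fin n) = d → (⟨i + 1, h⟩ : Fin n) ∉ S := fun h => h ▸ hd
    simp only [Fin.lt_def, Fin.le_def, Fin.ext_iff] at *
    refine ⟨⟨h, ?_⟩, ?_, ?_⟩ <;> grind
  have h2 : ∀ i ∈ memberChanges (S \ Finset.Ioo b d), i ∈ memberChanges S ∧ (i < b ∨ d ≤ i) := by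
    intro i hi
    simp only [memberChanges, Finset.mem_filter, Finset.mem_univ, true_and, Finset.mem_sdiff,
      Finset.mem_Ioo] at hi ⊢
    obtain ⟨h, hi⟩ := hi
    have e1 : i = b → i ∉ S := fun h => h ▸ hb
    have e2 : i = d → i ∉ S := fun h => h ▸ hd
    have e3 : (⟨i + 1, h⟩ : Fin n) = b → (⟨i + 1, h⟩ : Fin n) ∉ S := fun h => h ▸ hb
    have e4 : (⟨i + 1, h⟩ : Fin n) = d → (⟨i + 1, h⟩ : Fin n) ∉ S := fun h => h ▸ hd
    simp only [Fin.lt_def, Fin.le_def, Fin.ext_iff] at *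
    refine ⟨⟨h, ?_⟩, ?_⟩ <;> grind
  obtain ⟨j, hj, hj1, hj2⟩ := exists_mem_memberChanges hab (S := S) (by tauto)
  obtain ⟨l, hl, hl'⟩ : ∃ l ∈ memberChanges S, l < b ∨ d ≤ l := by
    rcases hcbd with hcb | hdc
    · obtain ⟨l, hl, -, h⟩ := exists_mem_memberChanges hcb (S := S) (by tauto)
      exact ⟨l, hl, Or.inl h⟩
    · obtain ⟨l, hl, h, -⟩ := exists_mem_memberChanges hdc (S := S) (by tauto)
      exact ⟨l, hl, Or.inr h⟩
  constructor
  · refine Finset.card_lt_card ⟨fun i hi => (h1 i hi).1, fun hsub => ?_⟩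
    have := (h1 l (hsub hl)).2
    rcases hl' with h | h <;> order
  · refine Finset.card_lt_card ⟨fun i hi => (h2 i hi).1, fun hsub => ?_⟩
    have := (h2 j (hsub hj)).2
    rcases this with h | h <;> order

theorem exists_crossing_of_not_ordConnected {α : Type*} [LinearOrder α] {S : Set α}
    (h1 : ¬ S.OrdConnected) (h2 : ¬ Sᶜ.OrdConnected) :
    (∃ a c b d, a ∈ S ∧ c ∈ S ∧ b ∉ S ∧ d ∉ S ∧ a < c ∧ a < b ∧ b < c ∧ (d < a ∨ c < d)) := by
  simp only [Set.ordConnected_iff, not_forall, Set.not_subset, Set.mem_Icc] at h1 h2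
  obtain ⟨x, hx, z, hz, _, y, ⟨hxy, hyz⟩, hy⟩ := h1
  obtain ⟨x', hx', z', hz', _, y', ⟨hxy', hyz'⟩, hy'⟩ := h2
  have lt : ∀ {p q : α}, p ≤ q → ¬ (p ∈ S ↔ q ∈ S) → p < q := by
    intro p q hpq h
    exact lt_of_le_of_ne hpq (by rintro rfl; exact h Iff.rfl)
  simp only [Set.mem_compl_iff, not_not] at hx' hz' hy'
  have := lt hxy (by tauto)
  have := lt hyz (by tauto)
  have := lt hxy' (by tauto)
  have := lt hyz' (by tauto)
  rcases le_total x' x with h | h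
  · exact ⟨x, z, y, x', hx, hz, hy, hx', by order, by order, by order, .inl (lt h (by tauto))⟩
  · have := lt h (by tauto)
    exact ⟨x, y', x', z', hx, hy', hx', hz', by order, by order, by order, .inr (by order)⟩

theorem card_inter_compl_add_card_inter_compl {α : Type*} [Fintype α] [DecidableEq α]
    (X S T : Finset α) :
    (X ∩ (Sᶜ ∩ T)ᶜ).card + (X ∩ (Sᶜ \ T)ᶜ).card = X.card + (X ∩ S).card := by
  rw [← Finset.card_union_add_card_inter]
  congr 2 <;> ext z <;> simp only [Finset.mem_union, Finset.mem_inter, Finset.mem_compl,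
    Finset.mem_sdiff] <;> tauto

/-- A relation in which crossing edges `R a c` and `R b d` force the edge `R b c` has, together
with any closed set meeting `K` more often than `B`, such a closed set which is an interval in the
cyclic order. -/
theorem exists_closed_ordConnected {n : ℕ} {R : Fin n → Fin n → Prop} {B K : Finset (Fin n)}
    (hcard : B.card = K.card)
    (hR : ∀ a b c d, R a c → R b d →
      (a ∈ Finset.Ioo (min b d) (max b d) ∧ c ∉ Finset.Icc (min b d) (max b d) ∨
        c ∈ Finset.Ioo (min b d) (max b d) ∧ a ∉ Finset.Icc (min b d) (max b d)) → R b c)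
    (S : Finset (Fin n)) (hS : ∀ x y, R x y → y ∈ S → x ∈ S)
    (hlt : (B ∩ S).card < (K ∩ S).card) :
    ∃ S : Finset (Fin n), (∀ x y, R x y → y ∈ S → x ∈ S) ∧ (B ∩ S).card < (K ∩ S).card ∧
      ((S : Set (Fin n)).OrdConnected ∨ (S : Set (Fin n))ᶜ.OrdConnected) := by
  induction hm : (memberChanges S).card using Nat.strong_induction_on generalizing S with
  | _ m ih =>
  subst hm
  by_cases hOC : (S : Set (Fin n)).OrdConnected ∨ (S : Set (Fin n))ᶜ.OrdConnected
  · exact ⟨S, hS, hlt, hOC⟩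
  rw [not_or] at hOC
  obtain ⟨a, c, b, d, ha, hc, hb, hd, hac, hab, hbc, hdac⟩ :=
    exists_crossing_of_not_ordConnected hOC.1 hOC.2
  simp only [Finset.mem_coe] at ha hc hb hd
  by_cases hsplit : ∃ b d a c, b ∉ S ∧ d ∉ S ∧ a ∈ S ∧ b < a ∧ a < d ∧ c ∈ S ∧ (c < b ∨ d < c) ∧
      ∀ x ∈ S, ∀ y ∈ S, R x y → (x ∈ Finset.Ioo b d ↔ y ∈ Finset.Ioo b d)
  · obtain ⟨b, d, a, c, hb, hd, ha, hba, had, hc, hcbd, hsplit⟩ := hsplit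
    obtain ⟨h1, h2⟩ := card_memberChanges_inter_lt hb hd ha hba had hc hcbd
    have hsum : ∀ X : Finset (Fin n), (X ∩ (S ∩ Finset.Ioo b d)).card +
        (X ∩ (S \ Finset.Ioo b d)).card = (X ∩ S).card := fun X => by
      rw [← Finset.inter_assoc, ← Finset.inter_sdiff_assoc, Finset.card_inter_add_card_sdiff]
    have hB := hsum B
    have hK := hsum K
    rcases lt_or_ge (B ∩ (S ∩ Finset.Ioo b d)).card (K ∩ (S ∩ Finset.Ioo b d)).card with h | h
    · refine ih _ h1 _ (fun x y hxy hy => ?_) h rfl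
      rw [Finset.mem_inter] at hy ⊢
      have hx := hS x y hxy hy.1
      exact ⟨hx, (hsplit x hx y hy.1 hxy).2 hy.2⟩
    · refine ih _ h2 _ (fun x y hxy hy => ?_) (by omega) rfl
      rw [Finset.mem_sdiff] at hy ⊢
      have hx := hS x y hxy hy.1
      exact ⟨hx, fun h => hy.2 ((hsplit x hx y hy.1 hxy).1 h)⟩
  · have hno : ∀ b d a c, b ∉ S → d ∉ S → a ∈ S → b < a → a < d → c ∈ S → (c < b ∨ d < c) →
        ¬ R b d ∧ ¬ R d b := by
      intro b d a c hb hd ha hba had hc hcbd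
      push Not at hsplit
      obtain ⟨x, hx, y, hy, hxy, hne⟩ := hsplit b d a c hb hd ha hba had hc hcbd
      have hbd : b < d := hba.trans had
      have ne : ∀ z ∈ S, z ∉ Finset.Ioo b d → z ∉ Finset.Icc b d := by
        intro z hz h h'
        rw [Finset.mem_Icc] at h'
        exact h (Finset.mem_Ioo.2 ⟨lt_of_le_of_ne h'.1 (by rintro rfl; exact hb hz),
          lt_of_le_of_ne h'.2 (by rintro rfl; exact hd hz)⟩)
      have hcr : x ∈ Finset.Ioo b d ∧ y ∉ Finset.Icc b d ∨
          y ∈ Finset.Ioo b d ∧ x ∉ Finset.Icc b d := by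
        have := ne x hx
        have := ne y hy
        tauto
      constructor
      · intro h
        refine hb (hS b y (hR x b y d hxy h ?_) hy)
        rwa [min_eq_left hbd.le, max_eq_right hbd.le]
      · intro h
        refine hd (hS d y (hR x d y b hxy h ?_) hy)
        rwa [min_eq_right hbd.le, max_eq_left hbd.le]
    have hnoR : ∀ x y, x ∉ S → y ∉ S → R x y → (x ∈ Finset.Ioo a c ↔ y ∈ Finset.Ioo a c) := by
      intro x y hx hy hxy
      have key : ∀ x y, x ∉ S → y ∉ S → x ∈ Finset.Ioo a c → y ∉ Finset.Ioo a c →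
          ¬ R x y ∧ ¬ R y x := by
        intro x y hx hy hxI hyI
        rw [Finset.mem_Ioo] at hxI hyI
        rcases lt_or_ge y a with h | h
        · exact (hno y x a c hy hx ha h hxI.1 hc (.inr hxI.2)).symm
        · have hya : a < y := lt_of_le_of_ne h (by rintro rfl; exact hy ha)
          have hcy : c < y := lt_of_le_of_ne (not_lt.1 fun h => hyI ⟨hya, h⟩)
            (by rintro rfl; exact hy hc)
          exact hno x y c a hx hy hc hxI.2 hcy ha (.inl hxI.1)
      by_contra hne
      by_cases hxI : x ∈ Finset.Ioo a c
      · exact (key x y hx hy hxI (by tauto)).1 hxy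
      · exact (key y x hy hx (by tauto) hxI).2 hxy
    obtain ⟨h1, h2⟩ := card_memberChanges_inter_lt (S := Sᶜ) (by simpa using ha)
      (by simpa using hc) (by simpa using hb) hab hbc (by simpa using hd) hdac
    rw [memberChanges_compl S, ← memberChanges_compl] at h1 h2
    have hsum : ∀ X : Finset (Fin n), (X ∩ (Sᶜ ∩ Finset.Ioo a c)ᶜ).card +
        (X ∩ (Sᶜ \ Finset.Ioo a c)ᶜ).card = X.card + (X ∩ S).card := fun X =>
      card_inter_compl_add_card_inter_compl X S _
    have hB := hsum B
    have hK := hsum K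
    rcases lt_or_ge (B ∩ (Sᶜ ∩ Finset.Ioo a c)ᶜ).card (K ∩ (Sᶜ ∩ Finset.Ioo a c)ᶜ).card with h | h
    · refine ih _ h1 _ (fun x y hxy hy => ?_) h rfl
      have h3 := hnoR x y
      have h4 := hS x y hxy
      simp only [Finset.mem_compl, Finset.mem_inter] at hy ⊢
      clear ih hR hno hsplit hsum hS hnoR
      tauto
    · refine ih _ h2 _ (fun x y hxy hy => ?_) (by omega) rfl
      have h3 := hnoR x y
      have h4 := hS x y hxy
      simp only [Finset.mem_compl, Finset.mem_sdiff] at hy ⊢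
      clear ih hR hno hsplit hsum hS hnoR
      tauto

section Sorting
variable {k n : ℕ}

theorem List.coe_eq_map_even_add_map_odd {α : Type*} (k : ℕ) (l : List α)
    (h : l.length = 2 * k) :
    (l : Multiset α) = Finset.univ.val.map (fun i : Fin k => l[2 * (i : ℕ)]) +
      Finset.univ.val.map (fun i : Fin k => l[2 * (i : ℕ) + 1]) := by
  simp only [Fin.univ_val_map, Multiset.coe_add, Multiset.coe_eq_coe]
  induction k generalizing l with
  | zero =>
    rw [mul_zero, List.length_eq_zero_iff] at h
    simp [h]
  | succ k ih =>
    match l, h with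
    | a :: b :: l, h =>
      have hl : l.length = 2 * k := by simp at h; omega
      rw [List.ofFn_succ, List.ofFn_succ]
      have e1 : ∀ i : Fin k, (a :: b :: l)[2 * (i.succ : ℕ)]'(by simp; omega) =
          l[2 * (i : ℕ)] := fun i => by simp [mul_add]
      have e2 : ∀ i : Fin k, (a :: b :: l)[2 * (i.succ : ℕ) + 1]'(by simp; omega) =
          l[2 * (i : ℕ) + 1] := fun i => by simp [mul_add]
      simp only [e1, e2]
      simpa using ((ih l hl).cons b).trans List.perm_middle.symm

/-- Of two interlacing sequences, the first meets an order-connected set at most once more often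
than the second. -/
theorem card_filter_le_card_filter_add_one {α : Type*} [LinearOrder α] {S : Set α}
    [DecidablePred (· ∈ S)] (hS : S.OrdConnected) {a b : Fin k → α}
    (h1 : ∀ i, a i ≤ b i) (h2 : ∀ i j, i < j → b i ≤ a j) :
    (Finset.univ.filter fun i => a i ∈ S).card ≤ (Finset.univ.filter fun i => b i ∈ S).card + 1 ∧
    (Finset.univ.filter fun i => b i ∈ S).card ≤
      (Finset.univ.filter fun i => a i ∈ S).card + 1 := by
  constructor
  · rcases (Finset.univ.filter fun i => a i ∈ S).eq_empty_or_nonempty with h | h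
    · simp [h]
    · rw [← Finset.card_erase_add_one (Finset.max'_mem _ h)]
      gcongr
      intro i hi
      have hlt := Finset.lt_max'_of_mem_erase_max' _ h hi
      have hm := Finset.max'_mem _ h
      simp only [Finset.mem_erase, Finset.mem_filter, Finset.mem_univ, true_and] at hi hm ⊢
      exact hS.out hi.2 hm ⟨h1 i, h2 _ _ hlt⟩
  · rcases (Finset.univ.filter fun i => b i ∈ S).eq_empty_or_nonempty with h | h
    · simp [h]
    · rw [← Finset.card_erase_add_one (Finset.min'_mem _ h)]
      gcongr
      intro i hi
      have hlt := Finset.min'_lt_of_mem_erase_min' _ h hi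
      have hm := Finset.min'_mem _ h
      simp only [Finset.mem_erase, Finset.mem_filter, Finset.mem_univ, true_and] at hi hm ⊢
      exact hS.out hm hi.2 ⟨h2 _ _ hlt, h1 i⟩

theorem sortedUnion_getElem_mono (I J : Set.powersetCard (Fin n) k) {i j : ℕ} (hij : i ≤ j)
    (hj : j < (sortedUnion I J).length) :
    (sortedUnion I J)[i]'(hij.trans_lt hj) ≤ (sortedUnion I J)[j] := by
  have h : (sortedUnion I J).Pairwise (· ≤ ·) := Multiset.pairwise_sort _ _
  rcases hij.eq_or_lt with rfl | hlt
  · exact le_rfl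
  · exact List.pairwise_iff_getElem.1 h i j _ hj hlt

/-- `sort₁` and `sort₂` are the ranges of interlacing strictly increasing sequences which
together enumerate the multiset union. -/
theorem exists_interlacing_sort (I J : Set.powersetCard (Fin n) k) :
    ∃ a b : Fin k → Fin n, (∀ i, a i ≤ b i) ∧ (∀ i j, i < j → b i ≤ a j) ∧
      StrictMono a ∧ StrictMono b ∧ sort₁ I J = Finset.univ.image a ∧
      sort₂ I J = Finset.univ.image b ∧
      (I : Finset (Fin n)).val + (J : Finset (Fin n)).val =
        Finset.univ.val.map a + Finset.univ.val.map b := by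
  have hlen := length_sortedUnion I J
  obtain ⟨a, ha⟩ : ∃ a : Fin k → Fin n, ∀ i, a i = (sortedUnion I J)[2 * (i : ℕ)] :=
    ⟨fun i => (sortedUnion I J)[2 * (i : ℕ)], fun _ => rfl⟩
  obtain ⟨b, hb⟩ : ∃ b : Fin k → Fin n, ∀ i, b i = (sortedUnion I J)[2 * (i : ℕ) + 1] :=
    ⟨fun i => (sortedUnion I J)[2 * (i : ℕ) + 1], fun _ => rfl⟩
  have hab : ∀ i, a i ≤ b i := fun i => by
    rw [ha, hb]; exact sortedUnion_getElem_mono I J (by omega) _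
  have hba : ∀ i j, i < j → b i ≤ a j := fun i j hij => by
    rw [Fin.lt_def] at hij
    rw [ha, hb]; exact sortedUnion_getElem_mono I J (by omega) _
  have hval : (I : Finset (Fin n)).val + (J : Finset (Fin n)).val =
      Finset.univ.val.map a + Finset.univ.val.map b := by
    have := List.coe_eq_map_even_add_map_odd k (sortedUnion I J) hlen
    simp only [← ha, ← hb] at this
    rw [← this, sortedUnion, Multiset.sort_eq]
  have hcount : ∀ x, (Finset.univ.filter fun i => x = a i).card +
      (Finset.univ.filter fun i => x = b i).card ≤ 2 := fun x => by
    have := congrArg (Multiset.count x) hval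
    rw [Multiset.count_add, Multiset.count_add, Multiset.count_map, Multiset.count_map] at this
    have hI := Multiset.nodup_iff_count_le_one.1 (I : Finset (Fin n)).nodup x
    have hJ := Multiset.nodup_iff_count_le_one.1 (J : Finset (Fin n)).nodup x
    simp only [Finset.card_def, Finset.filter_val]
    omega
  refine ⟨a, b, hab, hba, ?_, ?_, ?_, ?_, hval⟩
  · intro i j hij
    refine lt_of_le_of_ne ((hab i).trans (hba i j hij)) fun he => ?_
    have hbi : a i = b i := le_antisymm (hab i) (he ▸ hba i j hij)
    have h1 : 1 < (Finset.univ.filter fun l => a i = a l).card :=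
      Finset.one_lt_card.2 ⟨i, by simp, j, by simpa using he, hij.ne⟩
    have h2 : 0 < (Finset.univ.filter fun l => a i = b l).card :=
      Finset.card_pos.2 ⟨i, by simpa using hbi⟩
    have := hcount (a i)
    omega
  · intro i j hij
    refine lt_of_le_of_ne ((hba i j hij).trans (hab j)) fun he => ?_
    have hbi : b i = a j := le_antisymm (hba i j hij) (he ▸ hab j)
    have h1 : 1 < (Finset.univ.filter fun l => b i = b l).card :=
      Finset.one_lt_card.2 ⟨i, by simp, j, by simpa using he, hij.ne⟩
    have h2 : 0 < (Finset.univ.filter fun l => b i = a l).card :=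
      Finset.card_pos.2 ⟨j, by simpa using hbi⟩
    have := hcount (b i)
    omega
  · simp only [sort₁, ← ha]
  · simp only [sort₂, ← hb]

theorem card_sort₁ (I J : Set.powersetCard (Fin n) k) : (sort₁ I J).card = k := by
  obtain ⟨a, b, -, -, ha, -, h, -⟩ := exists_interlacing_sort I J
  rw [h, Finset.card_image_of_injective _ ha.injective, Finset.card_univ, Fintype.card_fin]

theorem card_sort₂ (I J : Set.powersetCard (Fin n) k) : (sort₂ I J).card = k := by
  obtain ⟨a, b, -, -, -, hb, -, h, -⟩ := exists_interlacing_sort I J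
  rw [h, Finset.card_image_of_injective _ hb.injective, Finset.card_univ, Fintype.card_fin]

theorem card_sort_inter (I J : Set.powersetCard (Fin n) k) {S : Finset (Fin n)}
    (hS : (S : Set (Fin n)).OrdConnected) :
    (sort₁ I J ∩ S).card + (sort₂ I J ∩ S).card =
        ((I : Finset (Fin n)) ∩ S).card + ((J : Finset (Fin n)) ∩ S).card ∧
      (sort₁ I J ∩ S).card ≤ (sort₂ I J ∩ S).card + 1 ∧
      (sort₂ I J ∩ S).card ≤ (sort₁ I J ∩ S).card + 1 := by
  obtain ⟨a, b, hab, hba, ha, hb, h1, h2, hval⟩ := exists_interlacing_sort I J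
  have key : ∀ f : Fin k → Fin n, StrictMono f → (Finset.univ.image f ∩ S).card =
      (Finset.univ.filter fun i => f i ∈ S).card := fun f hf => by
    rw [← Finset.filter_mem_eq_inter, Finset.filter_image,
      Finset.card_image_of_injective _ hf.injective]
  have hc := card_filter_le_card_filter_add_one hS hab hba
  simp only [Finset.mem_coe] at hc
  rw [h1, h2, key a ha, key b hb]
  refine ⟨?_, hc⟩
  have := congrArg (Multiset.countP (· ∈ S)) hval
  rw [Multiset.countP_add, Multiset.countP_add, Multiset.countP_map, Multiset.countP_map] at this
  simp only [← Finset.filter_mem_eq_inter, Finset.card_def, Finset.filter_val]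
  simpa only [Multiset.countP_eq_card_filter] using this.symm

/-- A cyclic interval meets `sort₁ I J` and `sort₂ I J` at most as often as one of `I`, `J`. -/
theorem card_sort_inter_le (I J : Set.powersetCard (Fin n) k) {S : Finset (Fin n)}
    (hS : (S : Set (Fin n)).OrdConnected ∨ (S : Set (Fin n))ᶜ.OrdConnected) :
    (sort₁ I J ∩ S).card ≤ max ((I : Finset (Fin n)) ∩ S).card ((J : Finset (Fin n)) ∩ S).card ∧
    (sort₂ I J ∩ S).card ≤
      max ((I : Finset (Fin n)) ∩ S).card ((J : Finset (Fin n)) ∩ S).card := by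
  rcases hS with hS | hS
  · have := card_sort_inter I J hS
    omega
  · rw [← Finset.coe_compl] at hS
    have h := card_sort_inter I J hS
    have key : ∀ X : Finset (Fin n), X.card = k → (X ∩ Sᶜ).card + (X ∩ S).card = k :=
      fun X hX => by
        rw [← hX, add_comm, ← Finset.sdiff_eq_inter_compl, Finset.card_inter_add_card_sdiff]
    have := key _ I.2
    have := key _ J.2
    have := key _ (card_sort₁ I J)
    have := key _ (card_sort₂ I J)
    omega

end Sorting

theorem Fin.exists_strictMono_insertNth {α : Type*} [LinearOrder α] {m : ℕ} {t : Fin m → α}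
    (ht : StrictMono t) {x : α} (hx : x ∉ Set.range t) :
    ∃ q : Fin (m + 1), (q : ℕ) = (Finset.univ.filter fun i => t i < x).card ∧
      StrictMono (q.insertNth (α := fun _ => α) x t) := by
  have hlt : ∀ i : Fin m, t i < x ↔ (i : ℕ) < (Finset.univ.filter fun i => t i < x).card := by
    intro i
    constructor
    · intro hi
      have : Finset.Iic i ⊆ Finset.univ.filter fun i => t i < x := fun j hj => by
        simpa using (ht.monotone (Finset.mem_Iic.1 hj)).trans_lt hi
      have := Finset.card_le_card this
      rw [Fin.card_Iic] at this
      omega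
    · intro hi
      by_contra hxi
      have : (Finset.univ.filter fun i => t i < x) ⊆ Finset.Iio i := fun j hj => by
        simp only [Finset.mem_filter, Finset.mem_univ, true_and] at hj
        rw [Finset.mem_Iio]
        exact ht.lt_iff_lt.1 (hj.trans_le (not_lt.1 hxi))
      have := Finset.card_le_card this
      rw [Fin.card_Iio] at this
      omega
  have hcard : (Finset.univ.filter fun i => t i < x).card < m + 1 :=
    Nat.lt_succ_of_le ((Finset.card_le_univ _).trans_eq (Fintype.card_fin m))
  refine ⟨⟨_, hcard⟩, rfl, (Fin.strictMono_insertNth_iff _ _ _).2 ⟨ht, fun i hi => ?_,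
    fun i hi => ?_⟩⟩
  · exact (hlt i).2 hi
  · refine lt_of_le_of_ne (not_lt.1 fun h => ?_) fun h => hx ⟨i, h.symm⟩
    have := (hlt i).1 h
    rw [Fin.le_def] at hi
    simp only [Fin.val_castSucc] at hi
    omega

/-- The number of inversions contributed by putting `x` in front of the sequence `t`, as a sign. -/
def insertSign {α : Type*} [LinearOrder α] {m : ℕ} (t : Fin m → α) (x : α) : ℝ :=
  (-1) ^ (Finset.univ.filter fun i => t i < x).card

theorem insertSign_mul_self {α : Type*} [LinearOrder α] {m : ℕ} (t : Fin m → α) (x : α) :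
    insertSign t x * insertSign t x = 1 := by
  rw [insertSign, ← pow_add, Even.neg_one_pow ⟨_, rfl⟩]

section

variable {E : Type*} [AddCommGroup E] [Module ℝ E] {n m : ℕ}

/-- Moving two vectors in front of a sequence, a form which is nonnegative on increasing sequences
of the vectors `v` changes by explicit signs. -/
theorem insertSign_mul_insertSign_mul_nonneg (ω : E [⋀^Fin (m + 2)]→ₗ[ℝ] ℝ) (v : Fin n → E)
    (hω : ∀ t : Fin (m + 2) → Fin n, StrictMono t → 0 ≤ ω (v ∘ t)) {t : Fin m → Fin n}
    (ht : StrictMono t) {x y : Fin n} (hxy : x < y) (hx : x ∉ Set.range t)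
    (hy : y ∉ Set.range t) :
    0 ≤ insertSign t x * insertSign t y *
      ω (Matrix.vecCons (v x) (Matrix.vecCons (v y) (v ∘ t))) := by
  obtain ⟨q, hq, hqt⟩ := Fin.exists_strictMono_insertNth ht hy
  have hx' : x ∉ Set.range (q.insertNth (α := fun _ => Fin n) y t) := by
    rw [Fin.range_insertNth]
    exact fun h => (Set.mem_insert_iff.1 h).elim hxy.ne hx
  obtain ⟨p, hp, hpt⟩ := Fin.exists_strictMono_insertNth hqt hx'
  have hp' : (p : ℕ) = (Finset.univ.filter fun i => t i < x).card := by
    rw [hp, ← Finset.card_map q.succAboveEmb]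
    congr 1
    ext j
    induction j using Fin.succAboveCases q with
    | x => simp [hxy.le]
    | p j => simp
  have hcomp : ∀ {l : ℕ} (q : Fin (l + 1)) (y : Fin n) (t : Fin l → Fin n),
      v ∘ (q.insertNth (α := fun _ => Fin n) y t) =
        q.insertNth (α := fun _ => E) (v y) (v ∘ t) := by
    intro l q y t
    ext j
    induction j using Fin.succAboveCases q <;> simp
  have h := hω _ hpt
  have h2 := (ω.curryLeft (v x)).map_insertNth q (v y) (v ∘ t)
  simp only [AlternatingMap.curryLeft_apply_apply] at h2
  rw [hcomp, AlternatingMap.map_insertNth, hcomp, h2, hp', hq] at h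
  simpa [insertSign, mul_assoc] using h

/-- An alternating form, restricted to its first two arguments, is the determinant of the
coordinates with respect to the first two of the vectors on which it is normalized. -/
theorem alternating_apply_eq_coord (ω : E [⋀^Fin (m + 2)]→ₗ[ℝ] ℝ) {ι : Type*} [DecidableEq ι]
    (bas : Module.Basis ι ℝ E) {a b : ι} (hab : a ≠ b) {t : Fin m → ι}
    (ha : a ∉ Set.range t) (hb : b ∉ Set.range t)
    (ht : ∀ i, i = a ∨ i = b ∨ i ∈ Set.range t) (x y : E) :
    ω (Matrix.vecCons x (Matrix.vecCons y (bas ∘ t))) =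
      ω (Matrix.vecCons (bas a) (Matrix.vecCons (bas b) (bas ∘ t))) *
        (bas.coord a x * bas.coord b y - bas.coord b x * bas.coord a y) := by
  let F : E →ₗ[ℝ] E →ₗ[ℝ] ℝ := LinearMap.mk₂ ℝ
    (fun x y => ω (Matrix.vecCons x (Matrix.vecCons y (bas ∘ t))))
    (by simp [← AlternatingMap.curryLeft_apply_apply])
    (by simp [← AlternatingMap.curryLeft_apply_apply])
    (by simp [← AlternatingMap.curryLeft_apply_apply])
    (by simp [← AlternatingMap.curryLeft_apply_apply])
  let G : E →ₗ[ℝ] E →ₗ[ℝ] ℝ := LinearMap.mk₂ ℝ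
    (fun x y => ω (Matrix.vecCons (bas a) (Matrix.vecCons (bas b) (bas ∘ t))) *
        (bas.coord a x * bas.coord b y - bas.coord b x * bas.coord a y))
    (by intros; simp only [map_add]; ring) (by intros; simp only [map_smul, smul_eq_mul]; ring)
    (by intros; simp only [map_add]; ring) (by intros; simp only [map_smul, smul_eq_mul]; ring)
  suffices h : F = G from congrArg (fun H => H x y) h
  have z1 : ∀ l y, ω (Matrix.vecCons (bas (t l)) (Matrix.vecCons y (bas ∘ t))) = 0 := fun l y =>
    ω.map_eq_zero_of_eq _ (i := 0) (j := l.succ.succ) (by simp) (Fin.succ_ne_zero _).symm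
  have z2 : ∀ l x, ω (Matrix.vecCons x (Matrix.vecCons (bas (t l)) (bas ∘ t))) = 0 := fun l x =>
    ω.map_eq_zero_of_eq _ (i := 1) (j := l.succ.succ) (by simp)
      (by rw [← Fin.succ_zero_eq_one, Ne, Fin.succ_inj]; exact (Fin.succ_ne_zero _).symm)
  have z3 : ∀ x, ω (Matrix.vecCons x (Matrix.vecCons x (bas ∘ t))) = 0 := fun x =>
    ω.map_eq_zero_of_eq _ (i := 0) (j := 1) (by simp) (by simp)
  have z4 : ω (Matrix.vecCons (bas b) (Matrix.vecCons (bas a) (bas ∘ t))) =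
      - ω (Matrix.vecCons (bas a) (Matrix.vecCons (bas b) (bas ∘ t))) := by
    have h := z3 (bas a + bas b)
    have h1 : F (bas a + bas b) (bas a + bas b) = 0 := h
    have h2 : F (bas a) (bas a) = 0 := z3 _
    have h3 : F (bas b) (bas b) = 0 := z3 _
    change F (bas b) (bas a) = - F (bas a) (bas b)
    simp only [map_add, LinearMap.add_apply] at h1
    linarith
  have hta : ∀ l, t l ≠ a := fun l h => ha ⟨l, h⟩
  have htb : ∀ l, t l ≠ b := fun l h => hb ⟨l, h⟩
  refine bas.ext fun i => bas.ext fun j => ?_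
  change ω (Matrix.vecCons (bas i) (Matrix.vecCons (bas j) (bas ∘ t))) =
      ω (Matrix.vecCons (bas a) (Matrix.vecCons (bas b) (bas ∘ t))) *
        (bas.coord a (bas i) * bas.coord b (bas j) - bas.coord b (bas i) * bas.coord a (bas j))
  simp only [Module.Basis.coord_apply, Module.Basis.repr_self]
  rcases ht i with rfl | rfl | ⟨l, rfl⟩
  · rcases ht j with rfl | rfl | ⟨l, rfl⟩
    · simp [z3, hab]
    · simp [hab, hab.symm]
    · simp [z2, hta, htb]
  · rcases ht j with rfl | rfl | ⟨l, rfl⟩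
    · simp [z4, hab, hab.symm]
    · simp [z3, hab.symm]
    · simp [z2, hta, htb]
  · simp [z1, hta, htb]
end

theorem bilinear_crossing {α : Type*} [LinearOrder α] (D : α → α → ℝ) {a b c d : α}
    (hD : ∀ x y, D x y = - D y x)
    (hpos : ∀ x ∈ ({a, b, c, d} : Set α), ∀ y ∈ ({a, b, c, d} : Set α), x < y → 0 ≤ D x y)
    (hpl : D a b * D c d + D a d * D b c = 0)
    (hcr : a ∈ Set.Ioo (min b d) (max b d) ∧ c ∉ Set.Icc (min b d) (max b d) ∨
        c ∈ Set.Ioo (min b d) (max b d) ∧ a ∉ Set.Icc (min b d) (max b d)) :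
    D a b * D c d = 0 := by
  have key : 0 ≤ (D a b * D c d) * (D a d * D b c) := by
    have hab := hpos a (by simp) b (by simp)
    have hba := hpos b (by simp) a (by simp)
    have hcd := hpos c (by simp) d (by simp)
    have hdc := hpos d (by simp) c (by simp)
    have had := hpos a (by simp) d (by simp)
    have hda := hpos d (by simp) a (by simp)
    have hbc := hpos b (by simp) c (by simp)
    have hcb := hpos c (by simp) b (by simp)
    rw [hD b a] at hba
    rw [hD d c] at hdc
    rw [hD d a] at hda
    rw [hD c b] at hcb
    have p : ∀ {w x y z : ℝ}, 0 ≤ w → 0 ≤ x → 0 ≤ y → 0 ≤ z → 0 ≤ (w * x) * (y * z) :=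
      fun hw hx hy hz => mul_nonneg (mul_nonneg hw hx) (mul_nonneg hy hz)
    simp only [Set.mem_Ioo, Set.mem_Icc, not_and_or, not_le] at hcr
    rcases le_total b d with hbd | hbd
    · rw [min_eq_left hbd, max_eq_right hbd] at hcr
      rcases hcr with ⟨⟨h1, h2⟩, h | h⟩ | ⟨⟨h1, h2⟩, h | h⟩
      · linarith [p (hba h1) (hcd (by order)) (had h2) (hcb h)]
      · linarith [p (hba h1) (hdc h) (had h2) (hbc (by order))]
      · linarith [p (hab h) (hcd h2) (had (by order)) (hbc h1)]
      · linarith [p (hba (by order)) (hcd h2) (hda h) (hbc h1)]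
    · rw [min_eq_right hbd, max_eq_left hbd] at hcr
      rcases hcr with ⟨⟨h1, h2⟩, h | h⟩ | ⟨⟨h1, h2⟩, h | h⟩
      · linarith [p (hab h2) (hcd h) (hda h1) (hcb (by order))]
      · linarith [p (hab h2) (hdc (by order)) (hda h1) (hbc h)]
      · linarith [p (hab (by order)) (hdc h1) (had h) (hcb h2)]
      · linarith [p (hba h) (hdc h1) (hda (by order)) (hcb h2)]
  have h : D a d * D b c = -(D a b * D c d) := by linarith
  rw [h] at key
  have : (D a b * D c d) * (D a b * D c d) = 0 := by
    linarith [mul_self_nonneg (D a b * D c d)]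
  exact mul_self_eq_zero.1 this

/-- For a sequence of vectors with nonnegative maximal minors, non-vanishing coordinates of
crossing pairs with respect to a basis `B` of the sequence force a further one. -/
theorem coord_ne_zero_of_crossing {k n : ℕ} {v : Fin n → Fin k → ℝ}
    (hv : ∀ t : Fin k → Fin n, StrictMono t → 0 ≤ Matrix.det (v ∘ t)) {B : Finset (Fin n)}
    (bas : Module.Basis B ℝ (Fin k → ℝ)) (hbas : ∀ i, bas i = v i) {a b : B} {c d : Fin n}
    (hc : c ∉ B) (hd : d ∉ B) (hac : bas.coord a (v c) ≠ 0) (hbd : bas.coord b (v d) ≠ 0)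
    (hcr : (a : Fin n) ∈ Set.Ioo (min (b : Fin n) d) (max (b : Fin n) d) ∧
          c ∉ Set.Icc (min (b : Fin n) d) (max (b : Fin n) d) ∨
        c ∈ Set.Ioo (min (b : Fin n) d) (max (b : Fin n) d) ∧
          (a : Fin n) ∉ Set.Icc (min (b : Fin n) d) (max (b : Fin n) d)) :
    bas.coord b (v c) ≠ 0 := by
  intro hbc
  have hab : a ≠ b := by rintro rfl; exact hac hbc
  have hBk : B.card = k := by
    simpa using (Module.finrank_eq_card_basis bas).symm
  have hab' : (b : Fin n) ≠ a := fun h => hab (Subtype.ext h.symm)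
  have hbB : (b : Fin n) ∈ B.erase a := Finset.mem_erase.2 ⟨hab', b.2⟩
  obtain ⟨m, hm⟩ : ∃ m, ((B.erase a).erase b).card = m := ⟨_, rfl⟩
  have hk : k = m + 2 := by
    rw [Finset.card_erase_of_mem hbB, Finset.card_erase_of_mem a.2, hBk] at hm
    have : 1 < B.card := Finset.one_lt_card.2 ⟨a, a.2, b, b.2, hab'.symm⟩
    omega
  subst hk
  set t₀ := ((B.erase a).erase b).orderEmbOfFin hm
  have hmem : ∀ i, t₀ i ∈ (B.erase a).erase b := fun i => Finset.orderEmbOfFin_mem _ hm i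
  have htB : ∀ i, t₀ i ∈ B := fun i => Finset.mem_of_mem_erase (Finset.mem_of_mem_erase (hmem i))
  have hrange : Set.range t₀ = ((B.erase a).erase b : Finset (Fin n)) :=
    Finset.range_orderEmbOfFin _ hm
  let t : Fin m → B := fun i => ⟨t₀ i, htB i⟩
  have hnot : ∀ x ∈ ({(a : Fin n), (b : Fin n), c, d} : Set (Fin n)), x ∉ Set.range t₀ := by
    intro x hx h
    rw [hrange] at h
    simp only [Finset.coe_erase, Set.mem_sdiff, Finset.mem_coe, Set.mem_singleton_iff] at h
    simp only [Set.mem_insert_iff, Set.mem_singleton_iff] at hx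
    rcases hx with rfl | rfl | rfl | rfl <;> tauto
  have hat : a ∉ Set.range t := fun ⟨i, h⟩ => hnot a (by simp) ⟨i, congrArg Subtype.val h⟩
  have hbt : b ∉ Set.range t := fun ⟨i, h⟩ => hnot b (by simp) ⟨i, congrArg Subtype.val h⟩
  have htall : ∀ i, i = a ∨ i = b ∨ i ∈ Set.range t := by
    intro i
    by_contra! h
    have : (i : Fin n) ∈ Set.range t₀ := by
      rw [hrange]
      simp only [Finset.coe_erase, Set.mem_sdiff, Finset.mem_coe, Set.mem_singleton_iff]
      exact ⟨⟨i.2, fun h' => h.1 (Subtype.ext h')⟩, fun h' => h.2.1 (Subtype.ext h')⟩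
    obtain ⟨j, hj⟩ := this
    exact h.2.2 ⟨j, Subtype.ext hj⟩
  let ω : (Fin (m + 2) → ℝ) [⋀^Fin (m + 2)]→ₗ[ℝ] ℝ := Matrix.detRowAlternating
  have hvt : bas ∘ t = v ∘ t₀ := funext fun i => hbas _
  have hform := alternating_apply_eq_coord ω bas hab hat hbt htall
  set δ := ω (Matrix.vecCons (bas a) (Matrix.vecCons (bas b) (bas ∘ t)))
  have hδ0 : δ ≠ 0 := by
    have hinj : Function.Injective (Matrix.vecCons a (Matrix.vecCons b t)) := by
      refine Fin.cons_injective_iff.2 ⟨?_, Fin.cons_injective_iff.2 ⟨hbt, ?_⟩⟩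
      · rintro ⟨i, hi⟩
        induction i using Fin.cases with
        | zero => exact hab (by simpa using hi.symm)
        | succ i => exact hat ⟨i, by simpa using hi⟩
      · intro i j hij
        have h : (t i : Fin n) = t j := by rw [hij]
        exact t₀.injective h
    have hli := bas.linearIndependent.comp _ hinj
    have := Matrix.linearIndependent_rows_iff_isUnit.1
      (show LinearIndependent ℝ
        (Matrix.of (bas ∘ Matrix.vecCons a (Matrix.vecCons b t))).row from hli)
    rw [Matrix.isUnit_iff_isUnit_det, isUnit_iff_ne_zero] at this
    have hcomp : bas ∘ Matrix.vecCons a (Matrix.vecCons b t) =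
        Matrix.vecCons (bas a) (Matrix.vecCons (bas b) (bas ∘ t)) := by
      rw [Matrix.vecCons, Matrix.vecCons, Fin.comp_cons, Fin.comp_cons]
      rfl
    rw [hcomp] at this
    exact this
  let s := insertSign t₀
  let D : Fin n → Fin n → ℝ := fun x y => s x * s y *
    (δ * (bas.coord a (v x) * bas.coord b (v y) - bas.coord b (v x) * bas.coord a (v y)))
  have hs : ∀ x, s x ≠ 0 := fun x hx => by
    have := insertSign_mul_self t₀ x
    change s x * s x = 1 at this
    simp [hx] at this
  have haa : bas.coord a (v a) = 1 := by simp [← hbas]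
  have hba : bas.coord b (v a) = 0 := by simp [← hbas, hab]
  have hbb : bas.coord b (v b) = 1 := by simp [← hbas]
  have habc : bas.coord a (v b) = 0 := by simp [← hbas, hab.symm]
  have hzero := bilinear_crossing (a := (a : Fin n)) (b := b) (c := c) (d := d) D
    (fun x y => by simp only [D]; ring)
    (fun x hx y hy hxy => by
      simp only [D]
      rw [← hform, hvt]
      exact insertSign_mul_insertSign_mul_nonneg ω v hv t₀.strictMono hxy (hnot x hx)
        (hnot y hy))
    (by simp only [D, haa, hba, hbb, habc, hbc]; ring) hcr
  simp only [D, haa, hba, hbb, habc, hbc, mul_zero, zero_mul, sub_zero, mul_one,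
    mul_eq_zero, hs, hδ0, hac, hbd, or_self] at hzero

theorem LinearIndepOn.card_le_of_forall_mem_span {ι V : Type*} [AddCommGroup V] [Module ℝ V]
    {v : ι → V} {s t : Finset ι} (hs : LinearIndepOn ℝ v (s : Set ι))
    (h : ∀ i ∈ s, v i ∈ Submodule.span ℝ (v '' t)) : s.card ≤ t.card := by
  classical
  have hle : Submodule.span ℝ (v '' s) ≤ Submodule.span ℝ (v '' t) := by
    rw [Submodule.span_le]
    rintro _ ⟨i, hi, rfl⟩
    exact h i hi
  have h1 : Module.finrank ℝ (Submodule.span ℝ (v '' s)) = s.card := by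
    rw [Set.image_eq_range]
    exact (finrank_span_eq_card hs).trans (by simp)
  have h2 : Module.finrank ℝ (Submodule.span ℝ (v '' t)) ≤ t.card := by
    rw [← Finset.coe_image]
    exact (finrank_span_finset_le_card _).trans Finset.card_image_le
  have : FiniteDimensional ℝ (Submodule.span ℝ (v '' (t : Set ι))) :=
    FiniteDimensional.span_of_finite ℝ (t.finite_toSet.image v)
  have := Submodule.finrank_mono hle
  omega

namespace RealGr

variable {k n : ℕ}

theorem det_comp_nonneg {A : Matrix (Fin k) (Fin n) ℝ} (hA : ∀ I, 0 ≤ maximalMinor A I)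
    (t : Fin k → Fin n) (ht : StrictMono t) : 0 ≤ Matrix.det (A.col ∘ t) := by
  have hcard : (Finset.univ.image t).card = k := by
    rw [Finset.card_image_of_injective _ ht.injective, Finset.card_univ, Fintype.card_fin]
  have h := hA ⟨Finset.univ.image t, hcard⟩
  have ht' : t = (Finset.univ.image t).orderEmbOfFin hcard :=
    Finset.orderEmbOfFin_unique hcard (fun i => Finset.mem_image_of_mem _ (Finset.mem_univ i)) ht
  rw [maximalMinor, ← Matrix.det_transpose] at h
  rw [ht']
  exact h

/-- A `k`-element set which is not a base of a totally nonnegative `X` meets some cyclic interval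
more often than any base. -/
theorem exists_ordConnected_card_inter_lt {X : RealGr k n} (hX : X.IsTotallyNonneg)
    {K : Finset (Fin n)} (hKk : K.card = k) (hK : ¬ X.IsBase K) :
    ∃ S : Finset (Fin n), ((S : Set (Fin n)).OrdConnected ∨ (S : Set (Fin n))ᶜ.OrdConnected) ∧
      ∀ I : Finset (Fin n), X.IsBase I → (I ∩ S).card < (K ∩ S).card := by
  classical
  obtain ⟨A, hA, hpos⟩ := hX
  set v := A.col
  obtain ⟨B₁, hB₁K, -, hKB₁, hB₁⟩ := exists_linearIndepOn_extension
    (linearIndepOn_empty ℝ v) (Set.empty_subset (K : Set (Fin n)))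
  obtain ⟨B', -, hB₁B, hspan, hB⟩ := exists_linearIndepOn_extension hB₁ (Set.subset_univ _)
  obtain ⟨B, rfl⟩ : ∃ B : Finset (Fin n), (B : Set (Fin n)) = B' :=
    ⟨B'.toFinite.toFinset, by simp⟩
  have htop : Submodule.span ℝ (v '' (B : Set (Fin n))) = ⊤ := by
    obtain ⟨I, hI⟩ := X.exists_isBase
    rw [isBase_iff hA] at hI
    have hfr : Module.finrank ℝ (Submodule.span ℝ (v '' I)) = k := by
      rw [Set.image_eq_range]
      exact (finrank_span_eq_card hI.2).trans (by
        rw [← Nat.card_eq_fintype_card, Nat.card_coe_set_eq, hI.1])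
    have hItop : Submodule.span ℝ (v '' I) = ⊤ :=
      Submodule.eq_top_of_finrank_eq (by simp [hfr])
    rw [eq_top_iff, ← hItop, Submodule.span_le]
    exact (Set.image_mono (Set.subset_univ _)).trans hspan
  let bas : Module.Basis B ℝ (Fin k → ℝ) := Module.Basis.mk (v := fun i : B => v i) hB (by
    rw [← htop, Set.image_eq_range]; rfl)
  have hbas : ∀ i, bas i = v i := fun i => Module.Basis.mk_apply _ _ i
  have hBk : B.card = k := by
    simpa using (Module.finrank_eq_card_basis bas).symm
  have himage : ∀ T : Set (Fin n), T ⊆ B → v '' T = bas '' {i | (i : Fin n) ∈ T} := by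
    intro T hT
    ext x
    constructor
    · rintro ⟨i, hi, rfl⟩
      exact ⟨⟨i, hT hi⟩, hi, hbas _⟩
    · rintro ⟨i, hi, rfl⟩
      exact ⟨i, hi, (hbas _).symm⟩
  let R : Fin n → Fin n → Prop := fun x y => ∃ hx : x ∈ B, y ∉ B ∧ bas.coord ⟨x, hx⟩ (v y) ≠ 0
  have hKcl : ∀ x y, R x y → y ∈ K → x ∈ K := by
    rintro x y ⟨hx, hy, hxy⟩ hyK
    have hmem := hKB₁ ⟨y, hyK, rfl⟩
    rw [himage B₁ hB₁B, SetLike.mem_coe, Module.Basis.mem_span_image] at hmem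
    exact hB₁K (hmem (Finsupp.mem_support_iff.2 hxy))
  have hlt : (B ∩ K).card < (K ∩ K).card := by
    rw [Finset.inter_self]
    refine Finset.card_lt_card ⟨Finset.inter_subset_right, fun hsub => hK ?_⟩
    refine (isBase_iff hA _).2 ⟨by rw [Set.ncard_coe_finset, hKk], ?_⟩
    exact hB.mono fun i hi => Finset.mem_of_mem_inter_left (hsub hi)
  obtain ⟨S, hScl, hSlt, hS⟩ := exists_closed_ordConnected (R := R) (hBk.trans hKk.symm)
    (fun a b c d hac hbd hcr => by
      obtain ⟨ha, hc, hac⟩ := hac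
      obtain ⟨hb, hd, hbd⟩ := hbd
      exact ⟨hb, hc, coord_ne_zero_of_crossing (det_comp_nonneg hpos) bas hbas hc hd hac hbd
        (by simpa using hcr)⟩) K hKcl hlt
  refine ⟨S, hS, fun I hI => lt_of_le_of_lt ?_ hSlt⟩
  rw [isBase_iff hA] at hI
  refine LinearIndepOn.card_le_of_forall_mem_span (v := v)
    (hI.2.mono (by simp)) fun y hy => ?_
  have hyS := Finset.mem_of_mem_inter_right hy
  by_cases hyB : y ∈ B
  · exact Submodule.subset_span ⟨y, by simp [hyB, hyS], rfl⟩
  · rw [himage _ (by simp), Module.Basis.mem_span_image]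
    intro x hx
    simpa using hScl x y ⟨x.2, hyB, Finsupp.mem_support_iff.1 hx⟩ hyS

theorem matroid_isBase_iff (X : RealGr k n) (B : Set (Fin n)) : X.matroid.IsBase B ↔ X.IsBase B :=
  Iff.rfl

end RealGr

theorem mainTheorem8 (k n : ℕ) (M : Matroid (Fin n)) (hM : IsPositroid k M) :
    IsSortClosed M := by
  obtain ⟨X, hX, rfl⟩ := hM
  intro l I J hI hJ
  rw [X.matroid_isBase_iff] at hI hJ
  have hl : l = k := by
    obtain ⟨I', -, h⟩ := hI
    rw [Finset.coe_inj] at h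
    have h1 : (I : Finset (Fin n)).card = l := I.2
    have h2 : (I' : Finset (Fin n)).card = k := I'.2
    rw [← h1, ← h2, h]
  subst hl
  constructor
  · rw [X.matroid_isBase_iff]
    by_contra hK
    obtain ⟨S, hS, hlt⟩ := RealGr.exists_ordConnected_card_inter_lt hX (card_sort₁ I J) hK
    have := hlt _ hI
    have := hlt _ hJ
    have := (card_sort_inter_le I J hS).1
    omega
  · rw [X.matroid_isBase_iff]
    by_contra hK
    obtain ⟨S, hS, hlt⟩ := RealGr.exists_ordConnected_card_inter_lt hX (card_sort₂ I J) hK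
    have := hlt _ hI
    have := hlt _ hJ
    have := (card_sort_inter_le I J hS).2
    omega
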